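/- Let $\nu$ be a non-degenerate (not a point mass) Borel probability measure on $\mathbb R$ with support bounded from above, and let $m_0=\int x\,\nu(dx)\in[-\infty,\infty)$ be its mean. Definitions. For a non-degenerate probability measure $\mu$ with support bounded from above put $B=\max\{0,\sup\operatorname{supp}\mu\}$ and $\theta_+=1/B$ (with $1/0=\infty$). For $0<\theta<\theta_+$ let $M(\theta)=\int\frac{1}{1-\theta x}\,\mu(dx)$, $P_\theta(dx)=\frac{1}{M(\theta)(1-\theta x)}\,\mu(dx)$ and $m(\theta)=\int x\,P_\theta(dx)$. The function $\theta\mapsto m(\theta)$ is strictly increasing on $(0,\theta_+)$; its image is an open interval, called the domain of means of $\mu$, and its inverse is denoted by $\psi_\mu$. The pseudo-variance function of $\mu$ is $\mathbb V_\mu(m)=m\left(\frac{1}{\psi_\mu(m)}-m\right)$, for $m$ in the domain of means. For any probability measure $\mu$ on $\mathbb R$ let $G_\mu(z)=\int\frac{1}{z-x}\,\mu(dx)$, let $K_\mu$ be the inverse of the restriction of $G_\mu$ to a truncated cone $\{z:\operatorname{Im}z>M,\ |\operatorname{Re}z|<\eta\operatorname{Im}z\}$ ($\eta>0$, and $M>0$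 large enough) on which $G_\mu$ is univalent, and let $\mathcal R_\mu(w)=K_\mu(w)-1/w$. For $\alpha>0$, a probability measure $\rho$ is the free convolution power $\nu^{\boxplus\alpha}$ if $\mathcal R_\rho(w)=\alpha\,\mathcal R_\nu(w)$ for some truncated cone $\Gamma$ and all $w$ with $1/w\in\Gamma$ (for a given cone of univalence both sides are defined on such a set); $\nu^{\boxplus\alpha}$ is said to exist if there is such a $\rho$. Proposition. Let $\alpha>0$ be such that $\nu^{\boxplus\alpha}$ exists. Then the support of $\nu^{\boxplus\alpha}$ is bounded from above, and there is a real number $m_1>\alpha m_0$ such that for every real $m$ with $\alpha m_0<m<m_1$, the number $m$ lies in the domain of means of $\nu^{\boxplus\alpha}$, the number $m/\alpha$ lies in the domain of means of $\nu$, and $$\mathbb V_{\nu^{\boxplus\alpha}}(m)=\alpha\,\mathbb V_\nu(m/\alpha).$$ -/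

import Mathlib

open MeasureTheory Set

open scoped ENNReal

noncomputable section

namespace CSK

/-- The Cauchy transform `G_μ(z) = ∫ 1 / (z - x) μ(dx)`. -/
def cauchyTransform (μ : Measure ℝ) (z : ℂ) : ℂ :=
  ∫ x : ℝ, 1 / (z - (x : ℂ)) ∂μ

/-- The truncated cone (Stolz angle at infinity)
`Γ_{η,M} = {z ∈ ℂ⁺ : Im z > M, |Re z| < η Im z}`. -/
def truncatedCone (η M : ℝ) : Set ℂ :=
  {z : ℂ | M < z.im ∧ |z.re| < η * z.im}

/-- The compositional inverse `K_μ` of the restriction of `G_μ` to a domain `D`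
(meaningful on the image `G_μ(D)` when `G_μ` is injective on `D`). -/
def inverseCauchy (μ : Measure ℝ) (D : Set ℂ) (w : ℂ) : ℂ :=
  Function.invFunOn (cauchyTransform μ) D w

/-- The `R`-transform `R_μ(w) = K_μ(w) - 1 / w`, computed from the branch of `K_μ` with values
in `D`. -/
def rTransform (μ : Measure ℝ) (D : Set ℂ) (w : ℂ) : ℂ :=
  inverseCauchy μ D w - 1 / w

/-- `ρ` is the free additive convolution power `ν^{⊞ α}`: both Cauchy transforms are univalent on
a common truncated cone `D`, and the resulting `R`-transforms are defined and satisfy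
`R_ρ(w) = α R_ν(w)` for all `w` near `0` such that `1 / w` lies in some truncated cone.
(For every probability measure and every aperture, univalence, and the fact that the image
contains such a set of `w`, hold once the cone is truncated far enough, so that they do not
restrict `ν` or `ρ`.) -/
def IsFreeConvolutionPower (ν : Measure ℝ) (α : ℝ) (ρ : Measure ℝ) : Prop :=
  ∃ η > 0, ∃ M > 0,
    InjOn (cauchyTransform ν) (truncatedCone η M) ∧
    InjOn (cauchyTransform ρ) (truncatedCone η M) ∧
    ∃ η' > 0, ∃ M' > 0, ∀ w : ℂ, 1 / w ∈ truncatedCone η' M' →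
      w ∈ cauchyTransform ν '' truncatedCone η M ∧
      w ∈ cauchyTransform ρ '' truncatedCone η M ∧
      rTransform ρ (truncatedCone η M) w = (α : ℂ) * rTransform ν (truncatedCone η M) w

/-- `B(μ) = max {0, sup supp μ}`, for a measure with support bounded from above. -/
def upperBound (μ : Measure ℝ) : ℝ :=
  max 0 (sSup μ.support)

/-- The open parameter interval `(0, θ₊)` with `θ₊ = 1 / B(μ)`, where `1 / 0 = ∞`. -/
def thetaInterval (μ : Measure ℝ) : Set ℝ :=
  {θ : ℝ | 0 < θ ∧ θ * upperBound μ < 1}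

/-- The normalizing constant `M(θ) = ∫ 1 / (1 - θ x) μ(dx)`. -/
def normalizer (μ : Measure ℝ) (θ : ℝ) : ℝ :=
  ∫ x : ℝ, 1 / (1 - θ * x) ∂μ

/-- The member `P_θ(dx) = 1 / (M(θ) (1 - θ x)) μ(dx)` of the one-sided Cauchy-Stieltjes kernel
family generated by `μ`. -/
def kernelMeasure (μ : Measure ℝ) (θ : ℝ) : Measure ℝ :=
  μ.withDensity fun x : ℝ => ENNReal.ofReal (1 / (normalizer μ θ * (1 - θ * x)))

/-- The mean `m(θ) = ∫ x P_θ(dx)`. -/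
def kernelMean (μ : Measure ℝ) (θ : ℝ) : ℝ :=
  ∫ x : ℝ, x ∂(kernelMeasure μ θ)

/-- The domain of means `(m₀, m₊)`, the image of `(0, θ₊)` under `θ ↦ m(θ)`. -/
def domainOfMeans (μ : Measure ℝ) : Set ℝ :=
  kernelMean μ '' thetaInterval μ

/-- The inverse function `ψ` of `θ ↦ m(θ)` on `(0, θ₊)`. -/
def psi (μ : Measure ℝ) (m : ℝ) : ℝ :=
  Function.invFunOn (kernelMean μ) (thetaInterval μ) m

/-- The pseudo-variance function `𝕍(m) = m (1 / ψ(m) - m)`, for `m` in the domain of means. -/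
def pseudoVariance (μ : Measure ℝ) (m : ℝ) : ℝ :=
  m * (1 / psi μ m - m)

/-- The mean `∫ x μ(dx) ∈ [-∞, ∞)` of a measure with support bounded from above, as the integral
of the positive part minus the integral of the negative part. -/
def extendedMean (μ : Measure ℝ) : EReal :=
  ((∫⁻ x : ℝ, ENNReal.ofReal x ∂μ : ℝ≥0∞) : EReal) -
    ((∫⁻ x : ℝ, ENNReal.ofReal (-x) ∂μ : ℝ≥0∞) : EReal)

end CSK

end

/-! Put `u = 1 / θ`. The kernel mean becomes `u - 1 / G_μ(u)`, so at `m = m(θ)` one has `1 / ψ(m) -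
m = 1 / G_μ(u)` and `𝕍_μ(m) = m / G_μ(u)`. The relation `R_ρ = α R_ν` says `G_ρ(Φ(z)) = G_ν(z)` with
`Φ(z) = α z + (1 - α) / G_ν(z)`. At a large real `x`, the mean of `ρ` at `Φ(x)` is therefore `Φ(x) -
1 / G_ν(x) = α (x - 1 / G_ν(x))`, that is, `α` times the mean of `ν` at `x`; as the two Cauchy
transforms agree there, the formula follows (`meanFn_realTransport`, `pseudoVariance_meanFn`).

The work lies in reaching the real axis. The relation is given only inside a cone. For large `Re z`
the map `Φ` satisfies `Im Φ(z) ≥ κ Im z` (`exists_le_transport_im`), so the identity theorem carries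
the relation to a quadrant (`exists_eqOn_quadrant`). Comparing imaginary parts there bounds `∫ |Φ(z)
- t|⁻² ρ(dt)` down to the real axis, which leaves `ρ` no mass far to the right
(`exists_ae_le_of_isFreeConvolutionPower`). Then both sides extend continuously to real `x`.

Finally, the mean of `ν` decreases strictly in `u` and comes arbitrarily close to `m₀`
(`meanFn_strictAntiOn`, `exists_meanFn_lt`), so large `x` reach every `m` slightly above `α m₀`. -/

namespace CSK

open Filter Topology

/-! ### Kernel means as a function of `u = 1 / θ` on the real axis -/

section

variable {μ : Measure ℝ}

/-- The Cauchy transform on the real axis. -/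
noncomputable def realCauchy (μ : Measure ℝ) (u : ℝ) : ℝ :=
  ∫ t : ℝ, 1 / (u - t) ∂μ

/-- The mean of the kernel measure as a function of `u = 1 / θ`. -/
noncomputable def meanFn (μ : Measure ℝ) (u : ℝ) : ℝ :=
  u - 1 / realCauchy μ u

lemma ae_le_sSup_support (h : BddAbove μ.support) : ∀ᵐ t ∂μ, t ≤ sSup μ.support := by
  filter_upwards [Measure.support_mem_ae (μ := μ)] with t ht using le_csSup h ht

lemma ae_le_upperBound (h : BddAbove μ.support) : ∀ᵐ t ∂μ, t ≤ upperBound μ := by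
  filter_upwards [ae_le_sSup_support h] with t ht using ht.trans (le_max_right _ _)

lemma support_subset_Iic {L : ℝ} (h : ∀ᵐ t ∂μ, t ≤ L) : μ.support ⊆ Iic L :=
  Measure.support_subset_of_isClosed isClosed_Iic h

lemma inv_mem_thetaInterval {u : ℝ} (hu : upperBound μ < u) : u⁻¹ ∈ thetaInterval μ := by
  have h0 : 0 < u := (le_max_left _ _).trans_lt hu
  refine ⟨by positivity, ?_⟩
  rw [inv_mul_eq_div, div_lt_one h0]
  exact hu

lemma upperBound_lt_inv {θ : ℝ} (hθ : θ ∈ thetaInterval μ) : upperBound μ < θ⁻¹ := by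
  rw [← one_div, lt_div_iff₀ hθ.1, mul_comm]
  exact hθ.2

variable [IsProbabilityMeasure μ] {b : ℝ}

lemma integrable_one_div_sub (hb : ∀ᵐ t ∂μ, t ≤ b) {u : ℝ} (hu : b < u) :
    Integrable (fun t : ℝ => 1 / (u - t)) μ := by
  refine Integrable.of_bound (C := 1 / (u - b))
    (Measurable.aestronglyMeasurable (by fun_prop)) ?_
  filter_upwards [hb] with t ht
  rw [Real.norm_of_nonneg (by apply one_div_nonneg.2; linarith)]
  exact one_div_le_one_div_of_le (by linarith) (by linarith)

lemma realCauchy_pos (hb : ∀ᵐ t ∂μ, t ≤ b) {u : ℝ} (hu : b < u) : 0 < realCauchy μ u := by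
  refine (integral_pos_iff_support_of_nonneg_ae ?_ (integrable_one_div_sub hb hu)).2 ?_
  · filter_upwards [hb] with t ht
    apply one_div_nonneg.2
    linarith
  · have : (fun t : ℝ => 1 / (u - t)).support ∈ ae μ := by
      filter_upwards [hb] with t ht
      rw [Function.mem_support]
      exact (one_div_pos.2 (by linarith)).ne'
    rw [measure_congr (eventuallyEq_univ.2 this)]
    simp

lemma integral_div_sub (hb : ∀ᵐ t ∂μ, t ≤ b) {u : ℝ} (hu : b < u) (c : ℝ) :
    Integrable (fun t : ℝ => (t - c) / (u - t)) μ ∧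
      ∫ t, (t - c) / (u - t) ∂μ = (u - c) * realCauchy μ u - 1 := by
  have hi := integrable_one_div_sub hb hu
  have he : (fun t : ℝ => (t - c) / (u - t)) =ᵐ[μ] fun t => (u - c) * (1 / (u - t)) - 1 := by
    filter_upwards [hb] with t ht
    have : u - t ≠ 0 := by linarith
    field_simp
    ring
  refine ⟨(integrable_congr he).2 ((hi.const_mul _).sub (integrable_const _)), ?_⟩
  rw [integral_congr_ae he, integral_sub (hi.const_mul _) (integrable_const _),
    integral_const_mul]
  simp [realCauchy]

/-- The kernel measure has density proportional to `1 / (u - t)`, so this is the centering that the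
comparisons of means rest on. -/
lemma integral_sub_meanFn_div (hb : ∀ᵐ t ∂μ, t ≤ b) {u : ℝ} (hu : b < u) :
    ∫ t, (t - meanFn μ u) / (u - t) ∂μ = 0 := by
  have := (realCauchy_pos hb hu).ne'
  rw [(integral_div_sub hb hu _).2, meanFn]
  field_simp
  ring

lemma meanFn_lt (hb : ∀ᵐ t ∂μ, t ≤ b) {u : ℝ} (hu : b < u) : meanFn μ u < u := by
  have := one_div_pos.2 (realCauchy_pos hb hu)
  rw [meanFn]; linarith

/-- Non-degeneracy turns into strict inequalities here. -/
lemma integral_pos_of_ne {c : ℝ} (hc : μ ≠ Measure.dirac c) {f : ℝ → ℝ} (hf : Integrable f μ)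
    (h0 : 0 ≤ᵐ[μ] f) (hpos : ∀ᵐ t ∂μ, t ≠ c → 0 < f t) : 0 < ∫ t, f t ∂μ := by
  refine lt_of_le_of_ne (integral_nonneg_of_ae h0) fun h => hc ?_
  have h1 := (integral_eq_zero_iff_of_nonneg_ae h0 hf).1 h.symm
  have h2 : ∀ᵐ t ∂μ, t = c := by
    filter_upwards [h1, hpos] with t ht ht'
    by_contra hne
    exact (ht' hne).ne' ht
  have h3 : μ.map id = μ.map fun _ => c := Measure.map_congr h2
  simpa using h3

/-- Let `c` be the mean at `u`. The weight `1 / (u - t)`, rescaled to agree with `1 / (v - t)` at `t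
= c`, differs from it by `t - c` times a positive factor. Multiplying by `t - c` and integrating
gives `∫ (t - c) / (v - t) < 0`, so the mean at `v` is below `c`. -/
lemma meanFn_strictAntiOn (hb : ∀ᵐ t ∂μ, t ≤ b) (hμ : ∀ a, μ ≠ Measure.dirac a) :
    StrictAntiOn (meanFn μ) (Ioi b) := by
  intro u hu v hv huv
  rw [mem_Ioi] at hu hv
  set c := meanFn μ u with hc
  have hcu : c < u := meanFn_lt hb hu
  have h0 := integral_sub_meanFn_div hb hu
  rw [← hc] at h0
  have hI := (integral_div_sub hb hu c).1
  have hJ := (integral_div_sub hb hv c)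
  have key : ∀ t ≤ b, (t - c) / (u - t) * ((u - c) / (v - c)) - (t - c) / (v - t)
      = (t - c) ^ 2 * ((v - u) / ((v - c) * ((u - t) * (v - t)))) := by
    intro t ht
    have h1 : u - t ≠ 0 := by linarith
    have h2 : v - t ≠ 0 := by linarith
    have h3 : v - c ≠ 0 := by linarith
    field_simp
    ring
  have hq : ∀ t ≤ b, 0 < (v - u) / ((v - c) * ((u - t) * (v - t))) := by
    intro t ht
    apply div_pos (by linarith)
    exact mul_pos (by linarith) (mul_pos (by linarith) (by linarith))
  have hpos := integral_pos_of_ne (hμ c) ((hI.mul_const ((u - c) / (v - c))).sub hJ.1)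
    (by
      filter_upwards [hb] with t ht
      simp only [Pi.zero_apply, Pi.sub_apply]
      rw [key t ht]
      exact mul_nonneg (sq_nonneg _) (hq t ht).le)
    (by
      filter_upwards [hb] with t ht hne
      simp only [Pi.sub_apply]
      rw [key t ht]
      exact mul_pos (sq_pos_of_ne_zero (sub_ne_zero.2 hne)) (hq t ht))
  simp only [Pi.sub_apply] at hpos
  rw [integral_sub (hI.mul_const _) hJ.1, integral_mul_const, h0, hJ.2] at hpos
  have hg := realCauchy_pos hb hv
  have : v - c < 1 / realCauchy μ v := by
    rw [lt_div_iff₀ hg]; linarith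
  rw [meanFn]; linarith

lemma realCauchy_continuousOn (hb : ∀ᵐ t ∂μ, t ≤ b) : ContinuousOn (realCauchy μ) (Ioi b) := by
  intro u hu
  rw [mem_Ioi] at hu
  apply ContinuousAt.continuousWithinAt
  refine continuousAt_of_dominated (bound := fun _ => 1 / ((u - b) / 2))
    (Eventually.of_forall fun _ => Measurable.aestronglyMeasurable (by fun_prop)) ?_
    (integrable_const _) ?_
  · filter_upwards [lt_mem_nhds (show (u + b) / 2 < u by linarith)] with v hv
    filter_upwards [hb] with t ht
    rw [Real.norm_of_nonneg (by apply one_div_nonneg.2; linarith)]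
    exact one_div_le_one_div_of_le (by linarith) (by linarith)
  · filter_upwards [hb] with t ht
    have : u - t ≠ 0 := by linarith
    fun_prop (disch := assumption)

lemma meanFn_continuousOn (hb : ∀ᵐ t ∂μ, t ≤ b) : ContinuousOn (meanFn μ) (Ioi b) :=
  continuousOn_id.sub (continuousOn_const.div (realCauchy_continuousOn hb)
    fun _ hu => (realCauchy_pos hb hu).ne')

lemma kernelMean_eq (h : BddAbove μ.support) {θ : ℝ} (hθ : θ ∈ thetaInterval μ) :
    kernelMean μ θ = meanFn μ θ⁻¹ := by
  have hb := ae_le_upperBound h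
  have hu := upperBound_lt_inv hθ
  have h0 : 0 < θ := hθ.1
  set u := θ⁻¹ with hu'
  have hθu : θ = 1 / u := by simp [hu']
  have hu0 : 0 < u := by positivity
  have hg := realCauchy_pos hb hu
  have hn : normalizer μ θ = u * realCauchy μ u := by
    rw [normalizer, realCauchy, ← integral_const_mul]
    apply integral_congr_ae
    filter_upwards [hb] with t ht
    have h1 : u - t ≠ 0 := by linarith
    have h2 : 1 - 1 / u * t = (u - t) / u := by field_simp
    rw [hθu, h2]
    field_simp
  rw [kernelMean, kernelMeasure, integral_withDensity_eq_integral_toReal_smul (by fun_prop)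
    (by simp)]
  have : ∫ t, (ENNReal.ofReal (1 / (normalizer μ θ * (1 - θ * t)))).toReal • t ∂μ
      = ∫ t, (realCauchy μ u)⁻¹ * ((t - 0) / (u - t)) ∂μ := by
    apply integral_congr_ae
    filter_upwards [hb] with t ht
    have h1 : 0 < u - t := by linarith
    have h2 : normalizer μ θ * (1 - θ * t) = realCauchy μ u * (u - t) := by
      rw [hn, hθu]; field_simp
    rw [h2, ENNReal.toReal_ofReal (by positivity), smul_eq_mul]
    field_simp
    simp
  rw [this, integral_const_mul, (integral_div_sub hb hu 0).2, meanFn]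
  field_simp
  simp

lemma psi_eq (h : BddAbove μ.support) (hμ : ∀ a, μ ≠ Measure.dirac a) {u : ℝ}
    (hu : upperBound μ < u) :
    meanFn μ u ∈ domainOfMeans μ ∧ psi μ (meanFn μ u) = u⁻¹ := by
  have hk : kernelMean μ u⁻¹ = meanFn μ u := by
    rw [kernelMean_eq h (inv_mem_thetaInterval hu), inv_inv]
  refine ⟨⟨u⁻¹, inv_mem_thetaInterval hu, hk⟩, ?_⟩
  have hinj : InjOn (kernelMean μ) (thetaInterval μ) := by
    intro x hx y hy hxy
    rw [kernelMean_eq h hx, kernelMean_eq h hy] at hxy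
    exact inv_injective ((meanFn_strictAntiOn (ae_le_upperBound h) hμ).injOn
      (upperBound_lt_inv hx) (upperBound_lt_inv hy) hxy)
  rw [psi, ← hk]
  exact hinj.leftInvOn_invFunOn (inv_mem_thetaInterval hu)

lemma pseudoVariance_meanFn (h : BddAbove μ.support) (hμ : ∀ a, μ ≠ Measure.dirac a) {u : ℝ}
    (hu : upperBound μ < u) :
    pseudoVariance μ (meanFn μ u) = meanFn μ u * (1 / realCauchy μ u) := by
  rw [pseudoVariance, (psi_eq h hμ hu).2, meanFn]
  simp

lemma lintegral_ofReal_lt_top (hb : ∀ᵐ t ∂μ, t ≤ b) : ∫⁻ t, ENNReal.ofReal t ∂μ < ∞ := by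
  calc ∫⁻ t, ENNReal.ofReal t ∂μ ≤ ∫⁻ _, ENNReal.ofReal b ∂μ :=
        lintegral_mono_ae (by filter_upwards [hb] with t ht using ENNReal.ofReal_le_ofReal ht)
    _ < ∞ := by simp

/-- The same comparison with a constant weight, the case `v = ∞`; if the negative part is not
integrable, the mean is `⊥`. -/
lemma extendedMean_lt_meanFn (hb : ∀ᵐ t ∂μ, t ≤ b) (hμ : ∀ a, μ ≠ Measure.dirac a) {u : ℝ}
    (hu : b < u) : extendedMean μ < (meanFn μ u : EReal) := by
  have hP := lintegral_ofReal_lt_top hb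
  by_cases hN : ∫⁻ t, ENNReal.ofReal (-t) ∂μ = ∞
  · rw [extendedMean, hN, EReal.coe_ennreal_top, EReal.sub_top]
    exact EReal.bot_lt_coe _
  have hint : Integrable (fun t : ℝ => t) μ := by
    refine ⟨by fun_prop, ?_⟩
    rw [hasFiniteIntegral_iff_norm]
    calc ∫⁻ t, ENNReal.ofReal ‖t‖ ∂μ
        ≤ ∫⁻ t, (ENNReal.ofReal t + ENNReal.ofReal (-t)) ∂μ := by
          apply lintegral_mono
          intro t
          rcases le_total 0 t with h | h <;> simp [abs_of_nonneg, abs_of_nonpos, h]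
      _ = ∫⁻ t, ENNReal.ofReal t ∂μ + ∫⁻ t, ENNReal.ofReal (-t) ∂μ :=
          lintegral_add_left (by fun_prop) _
      _ < ∞ := ENNReal.add_lt_top.2 ⟨hP, lt_top_iff_ne_top.2 hN⟩
  have hE : extendedMean μ = ((∫ t, t ∂μ : ℝ) : EReal) := by
    rw [integral_eq_lintegral_pos_part_sub_lintegral_neg_part hint, EReal.coe_sub,
      EReal.coe_ennreal_toReal hP.ne, EReal.coe_ennreal_toReal hN, extendedMean]
  rw [hE, EReal.coe_lt_coe_iff]
  set c := meanFn μ u with hc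
  have hcu : c < u := meanFn_lt hb hu
  have h0 := integral_sub_meanFn_div hb hu
  rw [← hc] at h0
  have hI := (integral_div_sub hb hu c).1
  have hJ : Integrable (fun t : ℝ => t - c) μ := hint.sub (integrable_const _)
  have key : ∀ t ≤ b, (t - c) / (u - t) - (t - c) * (1 / (u - c))
      = (t - c) ^ 2 * (1 / ((u - t) * (u - c))) := by
    intro t ht
    have h1 : u - t ≠ 0 := by linarith
    have h3 : u - c ≠ 0 := by linarith
    field_simp
    ring
  have hq : ∀ t ≤ b, 0 < 1 / ((u - t) * (u - c)) := fun t ht =>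
    one_div_pos.2 (mul_pos (by linarith) (by linarith))
  have hpos := integral_pos_of_ne (hμ c) (hI.sub (hJ.mul_const (1 / (u - c))))
    (by
      filter_upwards [hb] with t ht
      simp only [Pi.zero_apply, Pi.sub_apply]
      rw [key t ht]
      exact mul_nonneg (sq_nonneg _) (hq t ht).le)
    (by
      filter_upwards [hb] with t ht hne
      simp only [Pi.sub_apply]
      rw [key t ht]
      exact mul_pos (sq_pos_of_ne_zero (sub_ne_zero.2 hne)) (hq t ht))
  simp only [Pi.sub_apply] at hpos
  rw [integral_sub hI (hJ.mul_const _), integral_mul_const, h0,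
    integral_sub hint (integrable_const _)] at hpos
  simp only [integral_const, probReal_univ, smul_eq_mul, one_mul, zero_sub] at hpos
  have h4 : 0 < 1 / (u - c) := one_div_pos.2 (by linarith)
  by_contra hcon
  push Not at hcon
  have := mul_nonneg (sub_nonneg.2 hcon) h4.le
  linarith

/-! ### Approach of the kernel means to the possibly infinite mean -/

lemma integrable_max_neg (hb : ∀ᵐ t ∂μ, t ≤ b) (N : ℝ) :
    Integrable (fun t : ℝ => max t (-N)) μ := by
  refine Integrable.of_bound (C := max |b| |N|) (by fun_prop) ?_
  filter_upwards [hb] with t ht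
  rw [Real.norm_eq_abs]
  have h1 := le_abs_self b
  have h2 := neg_abs_le N
  have h3 := neg_abs_le b
  have h4 := le_abs_self N
  have h5 := le_max_left |b| |N|
  have h6 := le_max_right |b| |N|
  have h7 := le_max_right t (-N)
  have h8 : max t (-N) ≤ max |b| |N| := by
    apply max_le <;> linarith [neg_abs_le N, abs_nonneg N, neg_le_abs N]
  exact abs_le.2 ⟨by linarith, h8⟩

/-- Truncating at `-N` keeps every integral finite; Fatou's lemma for the truncated negative parts
then passes to the limit and covers the mean `-∞`. -/
lemma le_extendedMean (hb : ∀ᵐ t ∂μ, t ≤ b) {c : ℝ}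
    (h : ∀ N : ℕ, c ≤ ∫ t, max t (-(N : ℝ)) ∂μ) : (c : EReal) ≤ extendedMean μ := by
  have hP := lintegral_ofReal_lt_top hb
  set P := (∫⁻ t, ENNReal.ofReal t ∂μ).toReal with hPdef
  have hpi : Integrable (fun t : ℝ => max t 0) μ := by simpa using integrable_max_neg hb 0
  have hPi : ∫ t, max t 0 ∂μ = P := by
    rw [integral_eq_lintegral_of_nonneg_ae (f := fun t : ℝ => max t 0)
      (Eventually.of_forall fun t => le_max_right _ _) (by fun_prop), hPdef]
    congr 2 with t
    rcases le_total 0 t with h | h <;> simp [h, ENNReal.ofReal_of_nonpos]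
  have hN : ∀ N : ℕ, ∫⁻ t, ENNReal.ofReal (min (-t) N) ∂μ ≤ ENNReal.ofReal (P - c) := by
    intro N
    have he : ∀ t : ℝ, ENNReal.ofReal (min (-t) N) = ENNReal.ofReal (max t 0 - max t (-N)) := by
      intro t
      have hN0 : (0 : ℝ) ≤ N := N.cast_nonneg
      rcases le_total 0 t with h | h
      · rw [max_eq_left h, max_eq_left (by linarith), sub_self,
          ENNReal.ofReal_of_nonpos ((min_le_left _ _).trans (by linarith)), ENNReal.ofReal_zero]
      · rw [max_eq_right h, zero_sub, ← min_neg_neg, neg_neg]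
    simp_rw [he]
    rw [← ofReal_integral_eq_lintegral_ofReal (f := fun t : ℝ => max t 0 - max t (-N)) (hpi.sub (integrable_max_neg hb N))]
    · apply ENNReal.ofReal_le_ofReal
      rw [integral_sub hpi (integrable_max_neg hb N), hPi]
      linarith [h N]
    · refine Eventually.of_forall fun t => sub_nonneg.2 (max_le_max le_rfl ?_)
      simp
  have hF : ∫⁻ t, ENNReal.ofReal (-t) ∂μ ≤ ENNReal.ofReal (P - c) := by
    calc ∫⁻ t, ENNReal.ofReal (-t) ∂μ
        ≤ ∫⁻ t, liminf (fun N : ℕ => ENNReal.ofReal (min (-t) N)) atTop ∂μ := by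
          apply lintegral_mono
          intro t
          refine le_of_eq (Tendsto.liminf_eq ?_).symm
          apply tendsto_const_nhds.congr'
          filter_upwards [eventually_ge_atTop ⌈-t⌉₊] with N hN
          rw [min_eq_left (Nat.ceil_le.1 hN)]
      _ ≤ liminf (fun N : ℕ => ∫⁻ t, ENNReal.ofReal (min (-t) N) ∂μ) atTop :=
          lintegral_liminf_le fun N => by fun_prop
      _ ≤ liminf (fun _ : ℕ => ENNReal.ofReal (P - c)) atTop :=
          liminf_le_liminf (Eventually.of_forall hN)
      _ = ENNReal.ofReal (P - c) := by simp
  have hPc : 0 ≤ P - c := by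
    have := h 0
    simp only [Nat.cast_zero, neg_zero] at this
    linarith
  have hF' : ((∫⁻ t, ENNReal.ofReal (-t) ∂μ : ℝ≥0∞) : EReal) ≤ ((P - c : ℝ) : EReal) := by
    have := EReal.coe_ennreal_le_coe_ennreal_iff.2 hF
    rwa [EReal.coe_ennreal_ofReal, max_eq_left hPc] at this
  rw [extendedMean, ← EReal.coe_ennreal_toReal hP.ne, ← hPdef]
  calc (c : EReal) = (P : EReal) - ((P - c : ℝ) : EReal) := by
        rw [← EReal.coe_sub]; congr 1; ring
    _ ≤ _ := EReal.sub_le_sub le_rfl hF'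

/-- Otherwise `∫ (t - c) u / (u - t) ≥ 0` for all large `u`. This survives replacing `t - c` by `max
t (-N) - c`, and `u → ∞` gives `∫ max t (-N) ≥ c` for every `N`. -/
lemma exists_meanFn_lt (hb : ∀ᵐ t ∂μ, t ≤ b) {c : ℝ} (hc : extendedMean μ < (c : EReal))
    (R : ℝ) : ∃ u > R, meanFn μ u < c := by
  by_contra! hcon
  refine hc.not_ge (le_extendedMean hb fun N => ?_)
  have hlim : Tendsto (fun u : ℝ => ∫ t, (max t (-(N : ℝ)) - c) * (u / (u - t)) ∂μ) atTop
      (𝓝 (∫ t, (max t (-(N : ℝ)) - c) ∂μ)) := by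
    refine tendsto_integral_filter_of_dominated_convergence
      (fun t => ‖max t (-(N : ℝ)) - c‖ * 2) (Eventually.of_forall fun u => by fun_prop) ?_
      (((integrable_max_neg hb N).sub (integrable_const c)).norm.mul_const 2) ?_
    -- For `t ≤ b` and `u > 2 |b|` the factor `u / (u - t)` is at most `2`.
    · filter_upwards [eventually_gt_atTop (2 * |b|)] with u hu
      filter_upwards [hb] with t ht
      have h1 := le_abs_self b
      have h2 : 0 < u - t := by linarith [abs_nonneg b]
      have h3 : 0 ≤ u / (u - t) := div_nonneg (by linarith [abs_nonneg b]) h2.le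
      rw [norm_mul, Real.norm_of_nonneg h3]
      gcongr
      rw [div_le_iff₀ h2]
      linarith
    · refine Eventually.of_forall fun t => ?_
      have h1 : Tendsto (fun u : ℝ => 1 + t / (u - t)) atTop (𝓝 (1 + 0)) :=
        tendsto_const_nhds.add
          (tendsto_const_nhds.div_atTop (tendsto_atTop_add_const_right _ _ tendsto_id))
      have h2 : Tendsto (fun u : ℝ => u / (u - t)) atTop (𝓝 1) := by
        rw [add_zero] at h1
        refine h1.congr' ?_
        filter_upwards [eventually_gt_atTop t] with u hu
        have : u - t ≠ 0 := by linarith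
        field_simp
        ring
      simpa using h2.const_mul (max t (-(N : ℝ)) - c)
  have hge : 0 ≤ ∫ t, (max t (-(N : ℝ)) - c) ∂μ := by
    refine ge_of_tendsto hlim ?_
    filter_upwards [eventually_gt_atTop (max R (2 * |b|))] with u hu
    have hbu : b < u := by linarith [le_abs_self b, abs_nonneg b, le_max_right R (2 * |b|)]
    have hu0 : 0 < u := by linarith [abs_nonneg b, le_max_right R (2 * |b|)]
    have hI := integral_div_sub hb hbu c
    have h0 := hcon u ((le_max_left _ _).trans_lt hu)
    have hg := realCauchy_pos hb hbu
    have h1 : 0 ≤ (u - c) * realCauchy μ u - 1 := by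
      rw [meanFn] at h0
      have : 1 / realCauchy μ u ≤ u - c := by linarith
      rw [div_le_iff₀ hg] at this
      linarith
    rw [← hI.2] at h1
    refine (mul_nonneg hu0.le h1).trans ?_
    rw [← integral_const_mul]
    refine integral_mono_ae (hI.1.const_mul _) ?_ ?_
    · have : Integrable (fun t : ℝ => u / (u - t)) μ := by
        simpa [div_eq_mul_inv] using (integrable_one_div_sub hb hbu).const_mul u
      refine this.bdd_mul (c := |max b (-N)| + N + |c|) (by fun_prop) ?_
      filter_upwards [hb] with t ht
      rw [Real.norm_eq_abs]
      have h3 : max t (-(N : ℝ)) ≤ max b (-N) := max_le_max ht le_rfl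
      have h4 := le_max_right t (-(N : ℝ))
      have h5 := le_abs_self (max b (-(N : ℝ)))
      have h6 := abs_nonneg (max b (-(N : ℝ)))
      have h7 : (0 : ℝ) ≤ N := N.cast_nonneg
      exact abs_le.2 ⟨by linarith [le_abs_self c, neg_abs_le c],
        by linarith [le_abs_self c, neg_abs_le c]⟩
    · filter_upwards [hb] with t ht
      have h2 : 0 < u - t := by linarith
      have : u * ((t - c) / (u - t)) = (t - c) * (u / (u - t)) := by ring
      rw [this]
      gcongr
      exact le_max_left _ _
  rw [integral_sub (integrable_max_neg hb N) (integrable_const _)] at hge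
  simpa using hge

end

/-! ### The complex Cauchy transform to the right of the support, and the map `Φ` -/

section

variable {μ : Measure ℝ} [IsProbabilityMeasure μ] {b : ℝ}

lemma integrable_one_div_complex_sub {z : ℂ} {r : ℝ} (hr : 0 < r)
    (h : ∀ᵐ t : ℝ ∂μ, r ≤ ‖z - t‖) : Integrable (fun t : ℝ => 1 / (z - (t : ℂ))) μ := by
  refine Integrable.of_bound (C := 1 / r) (Measurable.aestronglyMeasurable (by fun_prop)) ?_
  filter_upwards [h] with t ht
  rw [norm_div, norm_one]
  exact one_div_le_one_div_of_le hr ht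

lemma cauchyTransform_differentiableAt {z : ℂ} {r : ℝ} (hr : 0 < r)
    (h : ∀ᵐ t : ℝ ∂μ, r ≤ ‖z - t‖) : DifferentiableAt ℂ (cauchyTransform μ) z := by
  have hball : ∀ t : ℝ, r ≤ ‖z - t‖ → ∀ w ∈ Metric.ball z (r / 2), r / 2 ≤ ‖w - t‖ := by
    intro t ht w hw
    rw [mem_ball_iff_norm'] at hw
    have := norm_sub_le_norm_sub_add_norm_sub z w (t : ℂ)
    linarith
  refine (hasDerivAt_integral_of_dominated_loc_of_deriv_le (μ := μ)
    (F := fun (w : ℂ) (t : ℝ) => 1 / (w - (t : ℂ)))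
    (F' := fun (w : ℂ) (t : ℝ) => -1 / (w - (t : ℂ)) ^ 2) (bound := fun _ => 1 / (r / 2) ^ 2)
    (Metric.ball_mem_nhds z (half_pos hr))
    (Eventually.of_forall fun _ => Measurable.aestronglyMeasurable (by fun_prop))
    (integrable_one_div_complex_sub hr h)
    (Measurable.aestronglyMeasurable (by fun_prop)) ?_ (integrable_const _)
    ?_).2.differentiableAt
  · filter_upwards [h] with t ht w hw
    have := hball t ht w hw
    rw [norm_div, norm_neg, norm_one, norm_pow]
    gcongr
  · filter_upwards [h] with t ht w hw
    have h1 := hball t ht w hw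
    have h2 : w - (t : ℂ) ≠ 0 := by
      intro h0
      rw [h0, norm_zero] at h1
      linarith
    simpa [one_div] using ((hasDerivAt_id w).sub_const (t : ℂ)).fun_inv h2

lemma im_le_norm_sub (z : ℂ) (t : ℝ) : z.im ≤ ‖z - t‖ := by
  simpa using Complex.im_le_norm (z - t)

lemma re_sub_le_norm_sub (z : ℂ) (t : ℝ) : z.re - t ≤ ‖z - t‖ := by
  simpa using Complex.re_le_norm (z - t)

omit [IsProbabilityMeasure μ] in
lemma ae_re_sub_le (hb : ∀ᵐ t ∂μ, t ≤ b) (z : ℂ) : ∀ᵐ t : ℝ ∂μ, z.re - b ≤ ‖z - t‖ := by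
  filter_upwards [hb] with t ht
  linarith [re_sub_le_norm_sub z t]

lemma cauchyTransform_differentiableAt_of_im {z : ℂ} (hz : 0 < z.im) :
    DifferentiableAt ℂ (cauchyTransform μ) z :=
  cauchyTransform_differentiableAt hz (Eventually.of_forall (im_le_norm_sub z))

lemma cauchyTransform_differentiableAt_of_re (hb : ∀ᵐ t ∂μ, t ≤ b) {z : ℂ} (hz : b < z.re) :
    DifferentiableAt ℂ (cauchyTransform μ) z :=
  cauchyTransform_differentiableAt (sub_pos.2 hz) (ae_re_sub_le hb z)

omit [IsProbabilityMeasure μ] in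
lemma cauchyTransform_ofReal (x : ℝ) : cauchyTransform μ x = (realCauchy μ x : ℂ) := by
  rw [cauchyTransform, realCauchy, ← integral_complex_ofReal]
  simp

/-- The deviation `∫ (b - t) / (x - t) μ(dt)` of `(x - b) G_μ(x)` from `1`. -/
noncomputable def deviation (μ : Measure ℝ) (b x : ℝ) : ℝ :=
  1 - (x - b) * realCauchy μ x

lemma tendsto_deviation (hb : ∀ᵐ t ∂μ, t ≤ b) : Tendsto (deviation μ b) atTop (𝓝 0) := by
  have h : Tendsto (fun x => ∫ t, (t - b) / (x - t) ∂μ) atTop (𝓝 (∫ _, (0 : ℝ) ∂μ)) := by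
    refine tendsto_integral_filter_of_dominated_convergence (fun _ => 1)
      (Eventually.of_forall fun u => Measurable.aestronglyMeasurable (by fun_prop)) ?_
      (integrable_const _) ?_
    · filter_upwards [eventually_gt_atTop b] with u hu
      filter_upwards [hb] with t ht
      rw [norm_div, Real.norm_of_nonpos (by linarith), Real.norm_of_nonneg (by linarith),
        div_le_one (by linarith)]
      linarith
    · refine Eventually.of_forall fun t => ?_
      exact tendsto_const_nhds.div_atTop (tendsto_atTop_add_const_right _ _ tendsto_id)
  rw [integral_zero] at h
  have h2 := h.neg
  rw [neg_zero] at h2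
  refine h2.congr' ?_
  filter_upwards [eventually_gt_atTop b] with u hu
  rw [(integral_div_sub hb hu b).2, deviation]
  ring

/-- Since `|z - t| ≥ Re z - t`, the error on a whole vertical line is controlled by its value on the
real axis, uniformly in `Im z`. -/
lemma norm_mul_cauchyTransform_sub_one_le (hb : ∀ᵐ t ∂μ, t ≤ b) {z : ℂ} (hz : b < z.re) :
    ‖(z - b) * cauchyTransform μ z - 1‖ ≤ deviation μ b z.re := by
  have hi := integrable_one_div_complex_sub (sub_pos.2 hz) (ae_re_sub_le hb z)
  have hne : ∀ t ≤ b, z - (t : ℂ) ≠ 0 := by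
    intro t ht h0
    have := re_sub_le_norm_sub z t
    rw [h0, norm_zero] at this
    linarith
  have he : (z - b) * cauchyTransform μ z - 1 = ∫ t : ℝ, ((t : ℂ) - b) / (z - t) ∂μ := by
    have : (fun t : ℝ => ((t : ℂ) - b) / (z - t)) =ᵐ[μ] fun t => (z - b) * (1 / (z - t)) - 1 := by
      filter_upwards [hb] with t ht
      have := hne t ht
      field_simp
      ring
    rw [integral_congr_ae this, integral_sub (hi.const_mul _) (integrable_const _),
      integral_const_mul]
    simp [cauchyTransform]
  have hd : deviation μ b z.re = ∫ t, (b - t) / (z.re - t) ∂μ := by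
    have h1 : (fun t : ℝ => (b - t) / (z.re - t)) = fun t => -((t - b) / (z.re - t)) := by
      ext t; ring
    rw [h1, integral_neg, (integral_div_sub hb hz b).2, deviation]
    ring
  rw [he, hd]
  refine norm_integral_le_of_norm_le ?_ ?_
  · refine ((integral_div_sub hb hz b).1.neg).congr (Eventually.of_forall fun t => ?_)
    simp only [Pi.neg_apply]
    ring
  · filter_upwards [hb] with t ht
    have h1 := re_sub_le_norm_sub z t
    have h2 : ‖(t : ℂ) - b‖ = b - t := by
      rw [← Complex.ofReal_sub, Complex.norm_real, Real.norm_of_nonpos (by linarith)]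
      ring
    rw [norm_div, h2]
    exact div_le_div_of_nonneg_left (by linarith) (by linarith) h1

lemma one_sub_deviation_le (hb : ∀ᵐ t ∂μ, t ≤ b) {z : ℂ} (hz : b < z.re) :
    1 - deviation μ b z.re ≤ ‖z - b‖ * ‖cauchyTransform μ z‖ := by
  have h := norm_mul_cauchyTransform_sub_one_le hb hz
  have h2 := norm_sub_norm_le (1 : ℂ) (1 - (z - b) * cauchyTransform μ z)
  rw [norm_sub_rev 1, norm_one, sub_sub_cancel, norm_mul] at h2
  linarith

lemma cauchyTransform_ne_zero (hb : ∀ᵐ t ∂μ, t ≤ b) {z : ℂ} (hz : b < z.re)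
    (hd : deviation μ b z.re < 1) : cauchyTransform μ z ≠ 0 := by
  intro h
  have := one_sub_deviation_le hb hz
  rw [h, norm_zero, mul_zero] at this
  linarith

lemma cauchyTransform_im {z : ℂ} (hz : 0 < z.im) :
    Integrable (fun t : ℝ => 1 / ‖z - t‖ ^ 2) μ ∧
      (cauchyTransform μ z).im = -(z.im * ∫ t : ℝ, 1 / ‖z - t‖ ^ 2 ∂μ) := by
  have hi := integrable_one_div_complex_sub (μ := μ) hz (Eventually.of_forall (im_le_norm_sub z))
  have him : ∀ t : ℝ, RCLike.im (1 / (z - (t : ℂ))) = -(z.im * (1 / ‖z - t‖ ^ 2)) := by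
    intro t
    rw [RCLike.im_eq_complex_im, one_div, Complex.inv_im, Complex.normSq_eq_norm_sq]
    simp
    ring
  constructor
  · refine Integrable.of_bound (C := 1 / z.im ^ 2)
      (Measurable.aestronglyMeasurable (by fun_prop)) (Eventually.of_forall fun t => ?_)
    rw [Real.norm_of_nonneg (by positivity)]
    have := im_le_norm_sub z t
    gcongr
  · have h1 := integral_im hi
    simp_rw [him] at h1
    rw [integral_neg, integral_const_mul] at h1
    exact h1.symm

lemma integral_norm_sq_le (hb : ∀ᵐ t ∂μ, t ≤ b) {z : ℂ} (hz : b < z.re) (hz' : 0 < z.im) :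
    ∫ t : ℝ, 1 / ‖z - t‖ ^ 2 ∂μ ≤ 1 / ‖z - b‖ ^ 2 := by
  have h : ∫ t : ℝ, 1 / ‖z - t‖ ^ 2 ∂μ ≤ ∫ _ : ℝ, 1 / ‖z - b‖ ^ 2 ∂μ := by
    refine integral_mono_ae (cauchyTransform_im hz').1 (integrable_const _) ?_
    filter_upwards [hb] with t ht
    have h0 : 0 < ‖z - b‖ := (sub_pos.2 hz).trans_le (re_sub_le_norm_sub z b)
    refine one_div_le_one_div_of_le (by positivity) ?_
    rw [← Complex.normSq_eq_norm_sq, ← Complex.normSq_eq_norm_sq, Complex.normSq_apply,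
      Complex.normSq_apply]
    simp only [Complex.sub_re, Complex.ofReal_re, Complex.sub_im, Complex.ofReal_im]
    nlinarith
  simpa using h

lemma one_div_cauchyTransform_im (hb : ∀ᵐ t ∂μ, t ≤ b) {z : ℂ} (hz : b < z.re) (hz' : 0 < z.im)
    (hd : deviation μ b z.re < 1) :
    0 ≤ (1 / cauchyTransform μ z).im ∧
      (1 / cauchyTransform μ z).im ≤ z.im * (1 / (1 - deviation μ b z.re) ^ 2) := by
  have hI0 : 0 ≤ ∫ t : ℝ, 1 / ‖z - t‖ ^ 2 ∂μ := integral_nonneg fun t => by positivity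
  have hI := integral_norm_sq_le hb hz hz'
  have hG := norm_pos_iff.2 (cauchyTransform_ne_zero hb hz hd)
  have h1 := one_sub_deviation_le hb hz
  have hb0 : 0 < ‖z - b‖ := (sub_pos.2 hz).trans_le (re_sub_le_norm_sub z b)
  have he : (1 / cauchyTransform μ z).im
      = z.im * ((∫ t : ℝ, 1 / ‖z - t‖ ^ 2 ∂μ) / ‖cauchyTransform μ z‖ ^ 2) := by
    rw [one_div, Complex.inv_im, Complex.normSq_eq_norm_sq, (cauchyTransform_im hz').2]
    ring
  rw [he]
  refine ⟨by positivity, mul_le_mul_of_nonneg_left ?_ hz'.le⟩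
  calc (∫ t : ℝ, 1 / ‖z - t‖ ^ 2 ∂μ) / ‖cauchyTransform μ z‖ ^ 2
      ≤ (1 / ‖z - b‖ ^ 2) / ‖cauchyTransform μ z‖ ^ 2 := by gcongr
    _ = 1 / (‖z - b‖ * ‖cauchyTransform μ z‖) ^ 2 := by field_simp
    _ ≤ 1 / (1 - deviation μ b z.re) ^ 2 := by
        have : 0 < 1 - deviation μ b z.re := by linarith
        gcongr

/-- The map `Φ(z) = α z + (1 - α) / G_μ(z)`, for which `G_ρ ∘ Φ = G_μ` when `ρ = μ^{⊞ α}`. -/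
noncomputable def transport (μ : Measure ℝ) (α : ℝ) (z : ℂ) : ℂ :=
  α * z + (1 - α) * (1 / cauchyTransform μ z)

/-- The restriction of `transport` to the real axis. -/
noncomputable def realTransport (μ : Measure ℝ) (α x : ℝ) : ℝ :=
  α * x + (1 - α) * (1 / realCauchy μ x)

omit [IsProbabilityMeasure μ] in
lemma transport_ofReal (α x : ℝ) : transport μ α x = (realTransport μ α x : ℂ) := by
  rw [transport, realTransport, cauchyTransform_ofReal]
  push_cast
  rfl

lemma transport_differentiableAt (hb : ∀ᵐ t ∂μ, t ≤ b) (α : ℝ) {z : ℂ} (hz : b < z.re)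
    (hd : deviation μ b z.re < 1) : DifferentiableAt ℂ (transport μ α) z := by
  unfold transport
  have h1 := cauchyTransform_differentiableAt_of_re hb hz
  have h2 := cauchyTransform_ne_zero hb hz hd
  fun_prop (disch := assumption)

/-- For `α ≤ 1` both terms of `Im Φ` are nonnegative and the first suffices. For `α > 1` the second
is negative, but `Im (1 / G) ≤ (1 + o(1)) Im z` as `Re z → ∞`, so the sum is at least `(1 - o(1)) Im
z`. -/
lemma exists_le_transport_im (hb : ∀ᵐ t ∂μ, t ≤ b) {α : ℝ} (hα : 0 < α) :
    ∃ κ > 0, ∃ R > b, ∀ x ≥ R, deviation μ b x < 1 ∧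
      ∀ z : ℂ, z.re = x → 0 < z.im → κ * z.im ≤ (transport μ α z).im := by
  have hlim : Tendsto (fun x => (1 - α) * (1 / (1 - deviation μ b x) ^ 2)) atTop
      (𝓝 ((1 - α) * (1 / (1 - 0) ^ 2))) := by
    refine ((tendsto_const_nhds.div ((tendsto_const_nhds.sub (tendsto_deviation hb)).pow 2)
      (by norm_num))).const_mul _
  have hpos : 0 < min α (1 / 2) := lt_min hα (by norm_num)
  have hev := hlim.eventually (lt_mem_nhds
    (show 1 / 2 - α < (1 - α) * (1 / (1 - 0) ^ 2) by norm_num))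
  have hev2 := (tendsto_deviation hb).eventually (gt_mem_nhds zero_lt_one)
  obtain ⟨R, hR⟩ := eventually_atTop.1 (hev.and hev2)
  refine ⟨min α (1 / 2), hpos, max R (b + 1), by
    exact (lt_add_one b).trans_le (le_max_right _ _), fun x hx => ?_⟩
  obtain ⟨h1, h2⟩ := hR x ((le_max_left _ _).trans hx)
  refine ⟨h2, fun z hzx hz => ?_⟩
  subst hzx
  have hbz : b < z.re := by linarith [le_max_right R (b + 1)]
  obtain ⟨h3, h4⟩ := one_div_cauchyTransform_im hb hbz hz h2
  have him : (transport μ α z).im = α * z.im + (1 - α) * (1 / cauchyTransform μ z).im := by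
    rw [transport, Complex.add_im, Complex.im_ofReal_mul, ← Complex.ofReal_one,
      ← Complex.ofReal_sub, Complex.im_ofReal_mul]
  rw [him]
  rcases le_total α 1 with hα1 | hα1
  · have := mul_nonneg (sub_nonneg.2 hα1) h3
    have := mul_le_mul_of_nonneg_right (min_le_left α (1 / 2)) hz.le
    linarith
  · have h5 := mul_le_mul_of_nonneg_left h4 (sub_nonneg.2 hα1)
    have h6 := mul_le_mul_of_nonneg_right (min_le_right α (1 / 2)) hz.le
    have h7 := mul_lt_mul_of_pos_right h1 hz
    linarith

lemma tendsto_realTransport (hb : ∀ᵐ t ∂μ, t ≤ b) (α : ℝ) :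
    Tendsto (realTransport μ α) atTop atTop := by
  have h1 : Tendsto (fun x => α + (1 - α) * ((1 - b / x) / (1 - deviation μ b x))) atTop
      (𝓝 (α + (1 - α) * ((1 - 0) / (1 - 0)))) :=
    tendsto_const_nhds.add (((tendsto_const_nhds.sub (tendsto_const_nhds.div_atTop tendsto_id)).div
      (tendsto_const_nhds.sub (tendsto_deviation hb)) (by norm_num)).const_mul _)
  have h2 := tendsto_id.atTop_mul_pos (by norm_num) h1
  -- The factor with limit `1` is `Φ(x) / x`, because `1 / G(x) = (x - b) / (1 - deviation)`.
  refine h2.congr' ?_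
  filter_upwards [eventually_gt_atTop (max 0 b)] with x hx
  have hx0 : 0 < x := (le_max_left _ _).trans_lt hx
  have hxb : 0 < x - b := sub_pos.2 ((le_max_right _ _).trans_lt hx)
  have hg := realCauchy_pos hb (sub_pos.1 hxb)
  rw [deviation, realTransport, sub_sub_cancel, id]
  field_simp

lemma realTransport_continuousOn (hb : ∀ᵐ t ∂μ, t ≤ b) (α : ℝ) :
    ContinuousOn (realTransport μ α) (Ioi b) := by
  unfold realTransport
  have h := realCauchy_continuousOn hb
  have h0 : ∀ x ∈ Ioi b, realCauchy μ x ≠ 0 := fun x hx => (realCauchy_pos hb hx).ne'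
  fun_prop (disch := assumption)

end

/-! ### Locating mass by integrals of `|ζ - t|⁻²`, and the `R`-transform relation inside the cone -/

section

/-- A quadratic bound makes the derivative of the distribution function vanish on `(L, ∞)`; being
constant there, it equals its limit `1`. -/
lemma measure_Ioi_eq_zero_of_sq_bound {ρ : Measure ℝ} [IsProbabilityMeasure ρ] {L C : ℝ}
    (h : ∀ ξ > L, ∀ r > 0, ρ.real (Icc (ξ - r) (ξ + r)) ≤ C * r ^ 2) : ρ (Ioi L) = 0 := by
  set F : ℝ → ℝ := fun x => ρ.real (Iic x) with hF
  have hsq : ∀ x > L, ∀ y > L, |F y - F x| ≤ C * |y - x| ^ 2 := by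
    have hlt : ∀ x > L, ∀ y > L, x < y → |F y - F x| ≤ C * |y - x| ^ 2 := by
      intro x hx y _ hxy
      have h1 : F y - F x = ρ.real (Ioc x y) := by
        have h2 := measureReal_union (μ := ρ) (Iic_disjoint_Ioc (c := y) (le_refl x))
          measurableSet_Ioc
        rw [Iic_union_Ioc_eq_Iic hxy.le] at h2
        simp only [hF]
        linarith
      rw [h1, abs_of_nonneg measureReal_nonneg, abs_of_pos (sub_pos.2 hxy)]
      refine (measureReal_mono ?_).trans (h x hx (y - x) (sub_pos.2 hxy))
      intro t ht
      exact ⟨by linarith [ht.1], by linarith [ht.2]⟩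
    intro x hx y hy
    rcases lt_trichotomy x y with hxy | hxy | hxy
    · exact hlt x hx y hy hxy
    · simp [hxy]
    · rw [abs_sub_comm, abs_sub_comm y]
      exact hlt y hy x hx hxy
  have hderiv : ∀ x > L, HasDerivAt F 0 x := by
    intro x hx
    rw [hasDerivAt_iff_isLittleO]
    have hO : (fun y => F y - F x - (y - x) • (0 : ℝ)) =O[𝓝 x] fun y => (y - x) ^ 2 := by
      refine Asymptotics.IsBigO.of_bound C ?_
      filter_upwards [lt_mem_nhds hx] with y hy
      simpa using hsq x hx y hy
    refine hO.trans_isLittleO ?_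
    have := (Asymptotics.isLittleO_pow_id (𝕜 := ℝ) one_lt_two).comp_tendsto
      (show Tendsto (fun y => y - x) (𝓝 x) (𝓝 0) by
        simpa using (tendsto_id (α := ℝ) (x := 𝓝 x)).sub_const x)
    exact this
  have hconst : ∀ x > L, F x = 1 := by
    intro x hx
    have htop : Tendsto F atTop (𝓝 1) := by
      exact (ProbabilityTheory.tendsto_cdf_atTop ρ).congr (ProbabilityTheory.cdf_eq_real ρ)
    have hev : ∀ᶠ y in atTop, F y = F x := by
      filter_upwards [eventually_gt_atTop L] with y hy
      exact isOpen_Ioi.is_const_of_deriv_eq_zero isPreconnected_Ioi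
        (fun z hz => (hderiv z hz).differentiableAt.differentiableWithinAt)
        (fun z hz => (hderiv z hz).deriv) hy hx
    exact tendsto_nhds_unique (tendsto_const_nhds.congr' (hev.mono fun y hy => hy.symm)) htop
  have hx0 : ∀ x > L, ρ (Ioi x) = 0 := by
    intro x hx
    have h1 := hconst x hx
    rw [← measureReal_eq_zero_iff, ← compl_Iic, probReal_compl_eq_one_sub measurableSet_Iic]
    simp only [hF] at h1
    rw [h1, sub_self]
  have hU : Ioi L = ⋃ n : ℕ, Ioi (L + 1 / ((n : ℝ) + 1)) := by
    ext t
    simp only [mem_Ioi, mem_iUnion]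
    constructor
    · intro ht
      obtain ⟨n, hn⟩ := exists_nat_one_div_lt (sub_pos.2 ht)
      exact ⟨n, by linarith⟩
    · rintro ⟨n, hn⟩
      have : (0 : ℝ) < 1 / ((n : ℝ) + 1) := by positivity
      linarith
  rw [hU, measure_iUnion_null_iff]
  intro n
  have : (0 : ℝ) < 1 / ((n : ℝ) + 1) := by positivity
  exact hx0 _ (by linarith)

/-- Markov's inequality: on the interval `|ζ - t| ≤ r + |ζ - ξ|`. -/
lemma measureReal_Icc_mul_le {ρ : Measure ℝ} [IsProbabilityMeasure ρ] {ζ : ℂ} (hζ : 0 < ζ.im)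
    {ξ r : ℝ} (hr : 0 < r) :
    ρ.real (Icc (ξ - r) (ξ + r)) ≤
      (∫ t : ℝ, 1 / ‖ζ - t‖ ^ 2 ∂ρ) * (r + ‖ζ - ξ‖) ^ 2 := by
  have hI := (cauchyTransform_im (μ := ρ) hζ).1
  have hpos : 0 < (r + ‖ζ - ξ‖) ^ 2 := by positivity
  have h1 := mul_meas_ge_le_integral_of_nonneg (μ := ρ)
    (Eventually.of_forall fun t : ℝ => (by positivity : 0 ≤ 1 / ‖ζ - t‖ ^ 2)) hI
    (1 / (r + ‖ζ - ξ‖) ^ 2)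
  have h2 : ρ.real (Icc (ξ - r) (ξ + r)) ≤
      ρ.real {t : ℝ | 1 / (r + ‖ζ - ξ‖) ^ 2 ≤ 1 / ‖ζ - t‖ ^ 2} := by
    refine measureReal_mono ?_
    intro t ht
    have h3 : 0 < ‖ζ - t‖ := hζ.trans_le (im_le_norm_sub ζ t)
    have h4 : ‖ζ - t‖ ≤ r + ‖ζ - ξ‖ := by
      have h5 := norm_sub_le_norm_sub_add_norm_sub ζ (ξ : ℂ) (t : ℂ)
      have h6 : ‖(ξ : ℂ) - t‖ ≤ r := by
        rw [← Complex.ofReal_sub, Complex.norm_real, Real.norm_eq_abs, abs_le]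
        exact ⟨by linarith [ht.2], by linarith [ht.1]⟩
      linarith
    rw [mem_ofPred_eq]
    gcongr
  rw [one_div_mul_eq_div, div_le_iff₀ hpos] at h1
  exact h2.trans h1

variable {ν ρ : Measure ℝ} [IsProbabilityMeasure ν] [IsProbabilityMeasure ρ] {b α : ℝ}

omit [IsProbabilityMeasure ν] [IsProbabilityMeasure ρ] in
lemma isOpen_truncatedCone (η M : ℝ) : IsOpen (truncatedCone η M) :=
  (isOpen_lt continuous_const Complex.continuous_im).inter
    (isOpen_lt Complex.continuous_re.abs (continuous_const.mul Complex.continuous_im))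

omit [IsProbabilityMeasure ρ] in
lemma exists_eventually_cauchyTransform_transport (hb : ∀ᵐ t ∂ν, t ≤ b)
    (hρ : IsFreeConvolutionPower ν α ρ) (R : ℝ) :
    ∃ z₀ : ℂ, R < z₀.re ∧ 0 < z₀.im ∧
      ∀ᶠ z in 𝓝 z₀, cauchyTransform ρ (transport ν α z) = cauchyTransform ν z := by
  obtain ⟨η, hη, M, hM, hinj, -, η', hη', M', hM', h⟩ := hρ
  have hid : ∀ z ∈ truncatedCone η M, 1 / cauchyTransform ν z ∈ truncatedCone η' M' →
      cauchyTransform ρ (transport ν α z) = cauchyTransform ν z := by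
    intro z hz hz'
    obtain ⟨-, h2, h3⟩ := h _ hz'
    have h4 : inverseCauchy ν (truncatedCone η M) (cauchyTransform ν z) = z :=
      hinj.leftInvOn_invFunOn hz
    have h5 : cauchyTransform ρ (inverseCauchy ρ (truncatedCone η M) (cauchyTransform ν z))
        = cauchyTransform ν z := Function.invFunOn_eq h2
    have h6 : inverseCauchy ρ (truncatedCone η M) (cauchyTransform ν z) = transport ν α z := by
      -- With `w = G_ν(z)` the relation reads `K_ρ(w) - 1 / w = α (z - 1 / w)`, so `K_ρ(w) = Φ(z)`.
      rw [rTransform, rTransform, h4] at h3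
      rw [transport]
      linear_combination h3
    rwa [h6] at h5
  -- The ray `Re z = ε Im z` lies inside both apertures, and `Re z → ∞` along it, so the right
  -- half-plane estimates apply. They give `1 / G_ν(z) ~ z`, which puts `1 / G_ν(z)` in the second
  -- cone.
  set ε := min η η' / 2 with hε
  have hε0 : 0 < ε := half_pos (lt_min hη hη')
  have hεη : ε < η := by linarith [min_le_left η η', lt_min hη hη']
  have hεη' : ε < η' := by linarith [min_le_right η η', lt_min hη hη']
  let p : ℝ → ℂ := fun s => ⟨s * ε, s⟩
  have hp : Tendsto (fun s : ℝ => s * ε) atTop atTop := tendsto_id.atTop_mul_const hε0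
  have hdev : Tendsto (fun s => deviation ν b (s * ε)) atTop (𝓝 0) := (tendsto_deviation hb).comp hp
  have h1 : Tendsto (fun s => (p s - b) * cauchyTransform ν (p s)) atTop (𝓝 1) := by
    rw [tendsto_iff_norm_sub_tendsto_zero]
    refine squeeze_zero' (Eventually.of_forall fun _ => norm_nonneg _) ?_ hdev
    filter_upwards [hp.eventually (eventually_gt_atTop b)] with s hs
    exact norm_mul_cauchyTransform_sub_one_le hb hs
  have h2 : Tendsto (fun s : ℝ => (p s - b) / s) atTop (𝓝 (⟨ε, 1⟩ - 0)) := by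
    have h3 : Tendsto (fun s : ℝ => (b : ℂ) / s) atTop (𝓝 0) := by
      have := (tendsto_const_nhds (x := b)).div_atTop (tendsto_id (α := ℝ) (x := atTop))
      have := (Complex.continuous_ofReal.tendsto _).comp this
      simpa [Function.comp_def] using this
    refine (tendsto_const_nhds.sub h3).congr' ?_
    filter_upwards [eventually_gt_atTop 0] with s hs
    have hs0 : (s : ℂ) ≠ 0 := by exact_mod_cast hs.ne'
    have : p s = s * ⟨ε, 1⟩ := by
      apply Complex.ext <;> simp [p]
    rw [this]
    field_simp
  have h3 : Tendsto (fun s : ℝ => (1 / cauchyTransform ν (p s)) / s) atTop (𝓝 ⟨ε, 1⟩) := by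
    have h4 := h2.div h1 one_ne_zero
    rw [sub_zero, div_one] at h4
    refine h4.congr' ?_
    filter_upwards [hp.eventually (eventually_gt_atTop b)] with s hs
    have : p s - b ≠ 0 := by
      intro h0
      have := congrArg Complex.re h0
      simp [p] at this
      linarith
    simp only [Pi.div_apply]
    rw [div_div, mul_comm (s : ℂ), mul_assoc, div_mul_eq_div_div, div_self this, div_div]
  have him := (Complex.continuous_im.tendsto _).comp h3
  have hcc : Continuous fun z : ℂ => |z.re| - η' * z.im := by fun_prop
  have hre := (hcc.tendsto _).comp h3
  have hre' := hre.eventually (gt_mem_nhds (show |ε| - η' * 1 < 0 by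
    rw [abs_of_pos hε0]; linarith))
  have him' := him.eventually (lt_mem_nhds (show 1 / 2 < (1 : ℝ) by norm_num))
  -- `Im (1 / G_ν)` exceeds `s / 2` only, hence the threshold `2 * M'`.
  obtain ⟨s, hs1, hs2, hs3, hs4, hs5, hs6⟩ := (hre'.and (him'.and
    ((hp.eventually (eventually_gt_atTop R)).and ((hp.eventually (eventually_gt_atTop b)).and
    ((hdev.eventually (gt_mem_nhds zero_lt_one)).and
    (eventually_gt_atTop (max M (2 * M')))))))).exists
  have hsM : M < s := (le_max_left _ _).trans_lt hs6
  have hsM' : 2 * M' < s := (le_max_right _ _).trans_lt hs6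
  have hs0 : 0 < s := hM.trans hsM
  have hF : 1 / cauchyTransform ν (p s) ∈ truncatedCone η' M' := by
    simp only [Function.comp_apply, Complex.div_ofReal_im, Complex.div_ofReal_re] at hs1 hs2
    rw [abs_div, abs_of_pos hs0, ← mul_div_assoc, ← sub_div, div_lt_iff₀ hs0, zero_mul] at hs1
    rw [lt_div_iff₀ hs0] at hs2
    exact ⟨by linarith, by linarith⟩
  have hz : p s ∈ truncatedCone η M := by
    refine ⟨hsM, ?_⟩
    simp only [p]
    rw [abs_of_pos (by positivity), mul_comm]
    gcongr
  have hcont : ContinuousAt (fun z => 1 / cauchyTransform ν z) (p s) :=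
    continuousAt_const.div (cauchyTransform_differentiableAt_of_re hb hs4).continuousAt
      (cauchyTransform_ne_zero hb hs4 hs5)
  refine ⟨p s, hs3, hs0, ?_⟩
  filter_upwards [(isOpen_truncatedCone η M).mem_nhds hz,
    hcont.preimage_mem_nhds ((isOpen_truncatedCone η' M').mem_nhds hF)] with z h1 h2
  exact hid z h1 h2

end

/-! ### Continuation to a quadrant, support of `ρ`, and passage to the real axis -/

section

variable {ν ρ : Measure ℝ} [IsProbabilityMeasure ν] [IsProbabilityMeasure ρ] {b α : ℝ}

/-- `Φ` maps the quadrant into the upper half-plane, where `G_ρ` is analytic whatever the support of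
`ρ`; the identity theorem on the convex quadrant applies. -/
lemma exists_eqOn_quadrant (hb : ∀ᵐ t ∂ν, t ≤ b) (hα : 0 < α)
    (hρ : IsFreeConvolutionPower ν α ρ) :
    ∃ κ > 0, ∃ R > b, (∀ x > R, deviation ν b x < 1) ∧ ∀ z : ℂ, R < z.re → 0 < z.im →
      κ * z.im ≤ (transport ν α z).im ∧
        cauchyTransform ρ (transport ν α z) = cauchyTransform ν z := by
  obtain ⟨κ, hκ, R, hR, h⟩ := exists_le_transport_im hb hα
  obtain ⟨z₀, hz₀, hz₀', hev⟩ := exists_eventually_cauchyTransform_transport hb hρ R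
  let Q : Set ℂ := {z | R < z.re} ∩ {z | 0 < z.im}
  have hQ : IsOpen Q := (isOpen_lt continuous_const Complex.continuous_re).inter
    (isOpen_lt continuous_const Complex.continuous_im)
  have hQc : IsPreconnected Q :=
    ((convex_halfSpace_re_gt R).inter (convex_halfSpace_im_gt 0)).isPreconnected
  have him : ∀ z ∈ Q, 0 < (transport ν α z).im := fun z hz =>
    (mul_pos hκ hz.2).trans_le ((h z.re (le_of_lt hz.1)).2 z rfl hz.2)
  have h1 : DifferentiableOn ℂ (fun z => cauchyTransform ρ (transport ν α z)) Q := fun z hz =>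
    (DifferentiableAt.comp z (cauchyTransform_differentiableAt_of_im (him z hz))
      (transport_differentiableAt hb α (hR.trans hz.1)
        (h z.re (le_of_lt hz.1)).1)).differentiableWithinAt
  have h2 : DifferentiableOn ℂ (cauchyTransform ν) Q := fun z hz =>
    (cauchyTransform_differentiableAt_of_im hz.2).differentiableWithinAt
  have heq := (h1.analyticOnNhd hQ).eqOn_of_preconnected_of_eventuallyEq (h2.analyticOnNhd hQ) hQc
    ⟨hz₀, hz₀'⟩ hev
  exact ⟨κ, hκ, R, hR, fun x hx => (h x hx.le).1, fun z hz hz' =>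
    ⟨(h z.re hz.le).2 z rfl hz', heq ⟨hz, hz'⟩⟩⟩

lemma tendsto_add_mul_I (x : ℝ) :
    Tendsto (fun s : ℝ => (⟨x, s⟩ : ℂ)) (𝓝[>] 0) (𝓝 (x : ℂ)) := by
  have h : Continuous fun s : ℝ => (x : ℂ) + s * Complex.I := by fun_prop
  have h2 := (h.tendsto 0).mono_left (nhdsWithin_le_nhds (s := Ioi 0))
  simp only [Complex.ofReal_zero, zero_mul, add_zero] at h2
  exact h2.congr fun s => by apply Complex.ext <;> simp

lemma tendsto_transport (hb : ∀ᵐ t ∂ν, t ≤ b) {x : ℝ} (hx : b < x) (hd : deviation ν b x < 1) :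
    Tendsto (fun s : ℝ => transport ν α ⟨x, s⟩) (𝓝[>] 0) (𝓝 (realTransport ν α x : ℂ)) := by
  rw [← transport_ofReal]
  exact (transport_differentiableAt hb α (z := (x : ℂ)) hx hd).continuousAt.tendsto.comp
    (tendsto_add_mul_I x)

lemma exists_gt_realTransport_eq (hb : ∀ᵐ t ∂ν, t ≤ b) {R ξ : ℝ} (hR : b < R)
    (hξ : realTransport ν α (R + 1) < ξ) : ∃ x > R, realTransport ν α x = ξ := by
  obtain ⟨X, hX, hX'⟩ := (((tendsto_realTransport hb α).eventually (eventually_ge_atTop ξ)).and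
    (eventually_ge_atTop (R + 1))).exists
  have hc : ContinuousOn (realTransport ν α) (Icc (R + 1) X) :=
    (realTransport_continuousOn hb α).mono fun y hy => by
      rw [mem_Ioi]; linarith [hy.1]
  obtain ⟨x, hx, hx'⟩ := intermediate_value_Icc hX' hc ⟨hξ.le, hX⟩
  exact ⟨x, by linarith [hx.1], hx'⟩

/-- With `ζ = Φ(z)`, equality of imaginary parts reads `Im ζ ∫ |ζ - t|⁻² dρ = Im z ∫ |z - t|⁻² dν`.
As `Im ζ ≥ κ Im z`, the integral against `ρ` is at most `1 / (κ (R - b)²)`, so intervals of radius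
`r` about `ξ = Φ(x)` have mass `O(r²)`. -/
lemma exists_ae_le_of_isFreeConvolutionPower (hb : ∀ᵐ t ∂ν, t ≤ b) (hα : 0 < α)
    (hρ : IsFreeConvolutionPower ν α ρ) : ∃ L, ∀ᵐ t ∂ρ, t ≤ L := by
  obtain ⟨κ, hκ, R, hR, hd, h⟩ := exists_eqOn_quadrant hb hα hρ
  refine ⟨realTransport ν α (R + 1), ?_⟩
  have hz : ρ (Ioi (realTransport ν α (R + 1))) = 0 := by
    refine measure_Ioi_eq_zero_of_sq_bound (C := 1 / (κ * (R - b) ^ 2)) fun ξ hξ r hr => ?_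
    obtain ⟨x, hx, rfl⟩ := exists_gt_realTransport_eq hb hR hξ
    have hbx : b < x := hR.trans hx
    -- The radius `r` stays fixed while `s = Im z` tends to `0`, which removes the distance from `ζ`
    -- to `ξ`.
    have hlim : Tendsto (fun s : ℝ => 1 / (κ * (R - b) ^ 2) *
        (r + ‖transport ν α ⟨x, s⟩ - realTransport ν α x‖) ^ 2) (𝓝[>] 0)
        (𝓝 (1 / (κ * (R - b) ^ 2) * (r + 0) ^ 2)) :=
      (((tendsto_iff_norm_sub_tendsto_zero.1
        (tendsto_transport hb hbx (hd x hx))).const_add r).pow 2).const_mul _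
    rw [add_zero] at hlim
    refine ge_of_tendsto hlim ?_
    filter_upwards [self_mem_nhdsWithin] with s hs
    obtain ⟨h1, h2⟩ := h ⟨x, s⟩ hx hs
    set z : ℂ := ⟨x, s⟩
    set ζ := transport ν α z
    have hs0 : 0 < s := hs
    have hζ : 0 < ζ.im := (mul_pos hκ hs0).trans_le h1
    refine (measureReal_Icc_mul_le hζ hr).trans ?_
    gcongr
    have h3 : ζ.im * ∫ t : ℝ, 1 / ‖ζ - t‖ ^ 2 ∂ρ = s * ∫ t : ℝ, 1 / ‖z - t‖ ^ 2 ∂ν := by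
      have := congrArg Complex.im h2
      rw [(cauchyTransform_im hζ).2, (cauchyTransform_im (z := z) hs).2] at this
      exact neg_injective this
    have h4 : ∫ t : ℝ, 1 / ‖z - t‖ ^ 2 ∂ν ≤ 1 / (R - b) ^ 2 := by
      refine (integral_norm_sq_le hb (z := z) hbx hs).trans ?_
      have h5 : x - b ≤ ‖z - b‖ := re_sub_le_norm_sub z b
      have h6 : 0 < R - b := sub_pos.2 hR
      have h7 : R - b ≤ ‖z - b‖ := by linarith
      gcongr
    have h5 : 0 ≤ ∫ t : ℝ, 1 / ‖ζ - t‖ ^ 2 ∂ρ := integral_nonneg fun t => by positivity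
    have h6 : s * (κ * ∫ t : ℝ, 1 / ‖ζ - t‖ ^ 2 ∂ρ) ≤ s * (1 / (R - b) ^ 2) := by
      have h7 := mul_le_mul_of_nonneg_right h1 h5
      have h8 := mul_le_mul_of_nonneg_left h4 hs0.le
      calc s * (κ * ∫ t : ℝ, 1 / ‖ζ - t‖ ^ 2 ∂ρ)
          = κ * s * ∫ t : ℝ, 1 / ‖ζ - t‖ ^ 2 ∂ρ := by ring
        _ ≤ _ := h7
        _ = _ := h3
        _ ≤ _ := h8
    have h7 := le_of_mul_le_mul_left h6 hs0
    rw [← le_div_iff₀' hκ, div_div, mul_comm _ κ] at h7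
    exact h7
  rw [ae_iff]
  simpa [Ioi] using hz

/-- Once `ρ` has no mass beyond `L`, `G_ρ` is continuous at real points beyond `L`, and the quadrant
identity has boundary values. -/
lemma eventually_realCauchy_realTransport (hb : ∀ᵐ t ∂ν, t ≤ b) (hα : 0 < α)
    (hρ : IsFreeConvolutionPower ν α ρ) {L : ℝ} (hL : ∀ᵐ t ∂ρ, t ≤ L) :
    ∀ᶠ x in atTop, realCauchy ρ (realTransport ν α x) = realCauchy ν x := by
  obtain ⟨κ, hκ, R, hR, hd, h⟩ := exists_eqOn_quadrant hb hα hρ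
  filter_upwards [eventually_gt_atTop R,
    (tendsto_realTransport hb α).eventually (eventually_gt_atTop L)] with x hx hxL
  have hbx : b < x := hR.trans hx
  have h1 : Tendsto (fun s : ℝ => cauchyTransform ρ (transport ν α ⟨x, s⟩)) (𝓝[>] 0)
      (𝓝 (cauchyTransform ρ (realTransport ν α x : ℂ))) :=
    (cauchyTransform_differentiableAt_of_re hL (z := (realTransport ν α x : ℂ))
      hxL).continuousAt.tendsto.comp (tendsto_transport hb hbx (hd x hx))
  have h2 : Tendsto (fun s : ℝ => cauchyTransform ν ⟨x, s⟩) (𝓝[>] 0)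
      (𝓝 (cauchyTransform ν (x : ℂ))) :=
    (cauchyTransform_differentiableAt_of_re hb (z := (x : ℂ)) hbx).continuousAt.tendsto.comp
      (tendsto_add_mul_I x)
  have h3 := tendsto_nhds_unique (h1.congr' (by
    filter_upwards [self_mem_nhdsWithin] with s hs using (h ⟨x, s⟩ hx hs).2)) h2
  rw [cauchyTransform_ofReal, cauchyTransform_ofReal] at h3
  exact_mod_cast h3

omit [IsProbabilityMeasure ν] [IsProbabilityMeasure ρ] in
lemma meanFn_realTransport {x : ℝ}
    (h : realCauchy ρ (realTransport ν α x) = realCauchy ν x) :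
    meanFn ρ (realTransport ν α x) = α * meanFn ν x := by
  rw [meanFn, h, meanFn, realTransport]
  ring

lemma meanFn_dirac (a u : ℝ) : meanFn (Measure.dirac a) u = a := by
  simp [meanFn, realCauchy]

lemma coe_mul_lt_coe_iff (hα : 0 < α) {E : EReal} {m : ℝ} :
    (α : EReal) * E < (m : EReal) ↔ E < ((m / α : ℝ) : EReal) := by
  induction E with
  | bot => simp [EReal.coe_mul_bot_of_pos hα]
  | coe x =>
    rw [← EReal.coe_mul, EReal.coe_lt_coe_iff, EReal.coe_lt_coe_iff, lt_div_iff₀ hα, mul_comm]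
  | top => simp [EReal.coe_mul_top_of_pos hα]

end

end CSK


theorem mainTheorem6 (ν : MeasureTheory.Measure ℝ) [MeasureTheory.IsProbabilityMeasure ν]
    (hnondeg : ∀ a : ℝ, ν ≠ MeasureTheory.Measure.dirac a)
    (hbdd : BddAbove ν.support)
    (α : ℝ) (hα : 0 < α)
    (ρ : MeasureTheory.Measure ℝ) [MeasureTheory.IsProbabilityMeasure ρ]
    (hρ : CSK.IsFreeConvolutionPower ν α ρ) :
    BddAbove ρ.support ∧
    ∃ m₁ : ℝ, (α : EReal) * CSK.extendedMean ν < (m₁ : EReal) ∧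
      ∀ m : ℝ, (α : EReal) * CSK.extendedMean ν < (m : EReal) → m < m₁ →
        m ∈ CSK.domainOfMeans ρ ∧ m / α ∈ CSK.domainOfMeans ν ∧
        CSK.pseudoVariance ρ m = α * CSK.pseudoVariance ν (m / α) := by
  have hb := CSK.ae_le_upperBound hbdd
  obtain ⟨L, hL⟩ := CSK.exists_ae_le_of_isFreeConvolutionPower hb hα hρ
  have hρbdd : BddAbove ρ.support := bddAbove_Iic.mono (CSK.support_subset_Iic hL)
  refine ⟨hρbdd, ?_⟩
  have hanti := CSK.meanFn_strictAntiOn hb hnondeg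
  obtain ⟨R, hR⟩ := Filter.eventually_atTop.1
    (((CSK.eventually_realCauchy_realTransport hb hα hρ hL).and
    ((CSK.tendsto_realTransport hb α).eventually (Filter.eventually_gt_atTop (CSK.upperBound ρ)))).and
    (Filter.eventually_gt_atTop (CSK.upperBound ν)))
  have hmean : ∀ x ≥ R, CSK.meanFn ρ (CSK.realTransport ν α x) = α * CSK.meanFn ν x :=
    fun x hx => CSK.meanFn_realTransport (hR x hx).1.1
  -- A point mass has constant kernel mean, whereas `α * meanFn ν` is strictly decreasing.
  have hρnondeg : ∀ a, ρ ≠ Measure.dirac a := by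
    rintro a rfl
    have h1 := hmean R le_rfl
    have h2 := hmean (R + 1) (by linarith)
    rw [CSK.meanFn_dirac] at h1 h2
    have h3 := hanti (hR R le_rfl).2 (hR (R + 1) (by linarith)).2 (lt_add_one R)
    exact h3.ne' (mul_left_cancel₀ hα.ne' (h1.symm.trans h2))
  -- Means below this bound are attained at some `x ≥ R`, where the transported identities hold.
  refine ⟨α * CSK.meanFn ν R, ?_, fun m hm hm₁ => ?_⟩
  · rw [CSK.coe_mul_lt_coe_iff hα, mul_div_cancel_left₀ _ hα.ne']
    exact CSK.extendedMean_lt_meanFn hb hnondeg (hR R le_rfl).2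
  rw [CSK.coe_mul_lt_coe_iff hα] at hm
  obtain ⟨X, hX, hXm⟩ := CSK.exists_meanFn_lt hb hm R
  have hcont : ContinuousOn (CSK.meanFn ν) (Icc R X) :=
    (CSK.meanFn_continuousOn hb).mono fun y hy => (hR y hy.1).2
  obtain ⟨x, hx, hxm⟩ := intermediate_value_Icc' (f := CSK.meanFn ν) hX.le hcont
    ⟨hXm.le, (div_le_iff₀' hα).2 hm₁.le⟩
  obtain ⟨⟨h1, h2⟩, h3⟩ := hR x hx.1
  have hm' : m = CSK.meanFn ρ (CSK.realTransport ν α x) := by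
    rw [hmean x hx.1, hxm]
    field_simp
  refine ⟨hm' ▸ (CSK.psi_eq hρbdd hρnondeg h2).1, hxm ▸ (CSK.psi_eq hbdd hnondeg h3).1, ?_⟩
  -- Both pseudo-variances are the mean divided by the same value `G_ρ(Φ(x)) = G_ν(x)`, and the
  -- means differ by the factor `α`.
  rw [← hxm, CSK.pseudoVariance_meanFn hbdd hnondeg h3, hm',
    CSK.pseudoVariance_meanFn hρbdd hρnondeg h2, hmean x hx.1, h1]
  ring
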